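/- **Belt Theorem.** A one-counter net $\mathcal N=(Q,A,\delta)$ consists of finite sets $Q$ of control-states and $A$ of actions and a set $\delta\subseteq Q\times A\times\{-1,0,1\}\times Q$ of transitions; its size is $|Q|+|A|+|\delta|$. Its configurations are the pairs $qn$ with $q\in Q$, $n\in\mathbb N$, with steps $pm\xrightarrow{a}qn$ iff $(p,a,d,q)\in\delta$ and $n=m+d\ge 0$ for some $d$. For two nets $\mathcal N,\mathcal N'$ over the same actions, $qn\preccurlyeq q'n'$ means that $(qn,q'n')$ lies in the largest simulation, i.e. the largest relation $R$ such that for all $(x,x')\in R$ and every step $x\xrightarrow{a}y$ of $\mathcal N$ there is a step $x'\xrightarrow{a}y'$ of $\mathcal N'$ with $(y,y')\in R$. The product control graph of $\mathcal N,\mathcal N'$ has nodes $Q\times Q'$ and an edge from $(p,p')$ to $(q,q')$ for each pair of transitions $(p,a,d,q)\in\delta$, $(p',a,d',q')\in\delta'$ with the same action $a$. Let $\mathrm{scc}$ be the number of nodes of its largest strongly connected component, and $\mathrm{acyc}$ the number of edges of its longest path without repeated nodes (both $0$ if there are no nodes). A vector $(\rho,\rho')\in\mathbb Z^2$ is positive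 if $\rho,\rho'\ge 0$ and $(\rho,\rho')\ne(0,0)$. For $c\in\mathbb N$, a point $(n,n')$ is $c$-above $(\rho,\rho')$ if $n<t\rho-c$ and $n'>t\rho'+c$ for some real $t\ge 0$, and $c$-below $(\rho,\rho')$ if $n>t\rho+c$ and $n'<t\rho'-c$ for some real $t\ge 0$. There are polynomials $P,S$ with coefficients in $\mathbb N$ such that for any two one-counter nets $\mathcal N,\mathcal N'$ over the same actions, of total size $s$ (the sum of the two sizes), there is $c\in\mathbb N$ with $$c\le P(s)\qquad\text{and}\qquad c\le S(\mathrm{scc})+\mathrm{acyc}$$ such that for every $(q,q')\in Q\times Q'$ there is a positive vector $(\rho,\rho')$ with $\rho,\rho'\le P(s)$ and, for all $n,n'\in\mathbb N$: 1. if $(n,n')$ is $c$-above $(\rho,\rho')$, then $qn\preccurlyeq q'n'$; 2. if $(n,n')$ is $c$-below $(\rho,\rho')$, then $qn\not\preccurlyeq q'n'$. -/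

import Mathlib

universe u v w

/-- A one-counter net with control-states `Q` and action labels `A` (both finite wherever it
matters): a set of transitions `(p, a, d, q)` with counter change `d ∈ {-1, 0, 1}`. -/
structure OneCounterNet (Q : Type u) (A : Type v) where
  /-- The transitions. -/
  trans : Set (Q × A × SignType × Q)

/-- `R` is a simulation between the labelled transition systems with configurations `C`, `C'`
and step relations `step`, `step'` over the same actions. -/
def IsSimulation {C C' A : Type*} (step : A → C → C → Prop) (step' : A → C' → C' → Prop)
    (R : C → C' → Prop) : Prop :=
  ∀ c c', R c c' → ∀ a d, step a c d → ∃ d', step' a c' d' ∧ R d d'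

/-- The maximal simulation (the union of all simulations): `c'` simulates `c`. -/
def Simulates {C C' A : Type*} (step : A → C → C → Prop) (step' : A → C' → C' → Prop)
    (c : C) (c' : C') : Prop :=
  ∃ R : C → C' → Prop, IsSimulation step step' R ∧ R c c'

namespace OneCounterNet

/-- The steps of the labelled transition system induced on `Q × ℕ`. -/
def Step {Q A : Type*} (N : OneCounterNet Q A) (a : A) (x y : Q × ℕ) : Prop :=
  ∃ d : SignType, (x.1, a, d, y.1) ∈ N.trans ∧ (y.2 : ℤ) = (x.2 : ℤ) + (d : ℤ)

/-- The size of a net: the number of its states, actions and transitions. -/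
noncomputable def size {Q A : Type*} (N : OneCounterNet Q A) : ℕ :=
  Nat.card Q + Nat.card A + N.trans.ncard

/-- The configuration `q' n'` of `N'` simulates the configuration `q n` of `N`. -/
def Sim {Q Q' A : Type*} (N : OneCounterNet Q A) (N' : OneCounterNet Q' A)
    (q : Q) (n : ℕ) (q' : Q') (n' : ℕ) : Prop :=
  Simulates N.Step N'.Step (q, n) (q', n')

/-- The labelled edges of the product control graph of `N` and `N'`. -/
def ProductEdge {Q Q' A : Type*} (N : OneCounterNet Q A) (N' : OneCounterNet Q' A)
    (x : Q × Q') (l : A × SignType × SignType) (y : Q × Q') : Prop :=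
  (x.1, l.1, l.2.1, y.1) ∈ N.trans ∧ (x.2, l.1, l.2.2, y.2) ∈ N'.trans

/-- There is some edge from `x` to `y` in the product control graph. -/
def ProductAdj {Q Q' A : Type*} (N : OneCounterNet Q A) (N' : OneCounterNet Q' A)
    (x y : Q × Q') : Prop :=
  ∃ l, ProductEdge N N' x l y

/-- The strongly connected component of `x` in the product control graph. -/
def component {Q Q' A : Type*} (N : OneCounterNet Q A) (N' : OneCounterNet Q' A)
    (x : Q × Q') : Set (Q × Q') :=
  {y | Relation.ReflTransGen (ProductAdj N N') x y ∧ Relation.ReflTransGen (ProductAdj N N') y x}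

/-- The number of nodes of the largest strongly connected component of the product control
graph (`0` if the graph has no nodes). -/
noncomputable def scc {Q Q' A : Type*} (N : OneCounterNet Q A) (N' : OneCounterNet Q' A) : ℕ :=
  ⨆ x : Q × Q', (component N N' x).ncard

/-- The length (number of edges) of the longest acyclic path, i.e. path without repeated nodes,
of the product control graph (`0` if the graph has no nodes). -/
noncomputable def acyc {Q Q' A : Type*} (N : OneCounterNet Q A) (N' : OneCounterNet Q' A) : ℕ :=
  sSup {k : ℕ | ∃ π : Fin (k + 1) → Q × Q', Function.Injective π ∧
    ∀ i : Fin k, ProductAdj N N' (π i.castSucc) (π i.succ)}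

end OneCounterNet

/-- Positive integer vectors: both coordinates nonnegative, and not both zero. -/
def IsPositiveVector (ρ : ℤ × ℤ) : Prop :=
  0 ≤ ρ.1 ∧ 0 ≤ ρ.2 ∧ ρ ≠ (0, 0)

/-- The direction of a vector: the half-line that it spans. -/
def direction (ρ : ℤ × ℤ) : Set (ℝ × ℝ) :=
  {r | ∃ t : ℝ, 0 ≤ t ∧ r = (t * (ρ.1 : ℝ), t * (ρ.2 : ℝ))}

/-- The point `x` is `c`-above the vector `ρ`. -/
def IsAbove (c : ℕ) (ρ x : ℤ × ℤ) : Prop :=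
  ∃ r ∈ direction ρ, (x.1 : ℝ) < r.1 - (c : ℝ) ∧ (x.2 : ℝ) > r.2 + (c : ℝ)

/-- The point `x` is `c`-below the vector `ρ`. -/
def IsBelow (c : ℕ) (ρ x : ℤ × ℤ) : Prop :=
  ∃ r ∈ direction ρ, (x.1 : ℝ) > r.1 + (c : ℝ) ∧ (x.2 : ℝ) < r.2 - (c : ℝ)

/-! The simulation game is compared with finite games on the product control graph, one for each
slope in a monotone gapless list from `r 0 = 0` to `r K = 1`. The list consists of the slopes of
nonnegative vectors with entries at most `scc + 1`, so no effect of a cycle can distinguish slopes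
strictly between two neighbours. In the game at `r j` a path is extended until a node repeats.
Spoiler wants the closed cycle to have positive tilt, that is, to drift below the line; if its
effect is nonnegative, Spoiler must moreover win from the repeated node at the next lower slope.

Cutting out each closed cycle turns the finite game into a strategy for the infinite one. If Spoiler
does not win at `r j`, then far above that line Duplicator only closes cycles that do not drift
below it, or switches to a lower slope (`isSimulation_duplicatorInvariant`). If Spoiler wins at `r
j`, then already below the steeper line `r (j + 1)` Spoiler can drift below the line `r j` and
switch there, or close cycles that exhaust Duplicator's counter (`not_sim_of_spoilerWins`). The
first slope at which Spoiler does not win, or `r K` if there is none, is therefore the direction of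
the belt.

The distance kept from the line ensures that the player concerned has a positive counter. Within one
game the counters deviate from a base point by at most the length of a simple path. Consecutive
games almost share one simple path: each change of slope costs only `2 * scc`, so `acyc` enters the
bound once. -/

open Relation

/-! ### Longest simple paths and strongly connected components -/

section LongestPath

variable {V : Type*} (R : V → V → Prop)

/-- `l` is a path without repeated nodes starting in `v`. -/
def IsSimplePath (v : V) (l : List V) : Prop :=
  l.head? = some v ∧ l.IsChain R ∧ l.Nodup

/-- The number of edges of the longest path without repeated nodes starting in `v`. -/
noncomputable def longestPath (v : V) : ℕ :=
  sSup {k | ∃ l, IsSimplePath R v l ∧ l.length = k + 1}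

variable {R}

theorem List.IsChain.reflTransGen_of_mem {l : List V} (hl : l.IsChain R) {a x : V}
    (ha : l.head? = some a) (hx : x ∈ l) : ReflTransGen R a x := by
  induction l generalizing a with
  | nil => simp at hx
  | cons b l ih =>
    obtain rfl : b = a := by simpa using ha
    rcases List.mem_cons.1 hx with rfl | hx
    · exact .refl
    · cases l with
      | nil => simp at hx
      | cons c l =>
        rw [List.isChain_cons_cons] at hl
        exact .head hl.1 (ih hl.2 rfl hx)

theorem List.IsChain.reflTransGen_getLast {l : List V} (hl : l.IsChain R) {z x : V}
    (hz : l.getLast? = some z) (hx : x ∈ l) : ReflTransGen R x z := by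
  induction l with
  | nil => simp at hx
  | cons b l ih =>
    cases l with
    | nil =>
      obtain rfl : b = z := by simpa using hz
      obtain rfl : x = b := by simpa using hx
      exact .refl
    | cons c l =>
      have hz' : (c :: l).getLast? = some z := by simpa using hz
      rcases List.mem_cons.1 hx with rfl | hx
      · exact List.mem_of_getLast? hz |> hl.reflTransGen_of_mem rfl
      · exact ih (List.isChain_cons_cons.1 hl).2 hz' hx

theorem exists_isSimplePath_of_reflTransGen {a z : V} (h : ReflTransGen R a z) :
    ∃ l, IsSimplePath R a l ∧ l.getLast? = some z := by
  induction h using ReflTransGen.head_induction_on with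
  | refl => exact ⟨[z], by simp [IsSimplePath]⟩
  | @head a b hab _ ih =>
    obtain ⟨l, ⟨h1, h2, h3⟩, h4⟩ := ih
    by_cases ha : a ∈ l
    · obtain ⟨s, t, rfl⟩ := List.append_of_mem ha
      refine ⟨a :: t, ⟨rfl, (List.isChain_append.1 h2).2.1, (List.nodup_append.1 h3).2.1⟩, ?_⟩
      simpa [List.getLast?_append] using h4
    · cases l with
      | nil => simp at h1
      | cons c l =>
        obtain rfl : c = b := by simpa using h1
        exact ⟨a :: c :: l, ⟨rfl, by simp [hab, h2], by simp_all⟩, by simpa using h4⟩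

variable (R) in
/-- The strongly connected component of `x`. -/
def stronglyConnectedComponent (x : V) : Set V :=
  {y | ReflTransGen R x y ∧ ReflTransGen R y x}

theorem stronglyConnectedComponent_eq {a u : V} (h : a ∈ stronglyConnectedComponent R u) :
    stronglyConnectedComponent R a = stronglyConnectedComponent R u :=
  Set.ext fun _ => ⟨fun hx => ⟨h.1.trans hx.1, hx.2.trans h.2⟩,
    fun hx => ⟨h.2.trans hx.1, hx.2.trans h.1⟩⟩

variable [Finite V]

theorem List.Nodup.length_le_ncard {l : List V} (hl : l.Nodup) {s : Set V}
    (hs : ∀ x ∈ l, x ∈ s) : l.length ≤ s.ncard := by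
  classical
  rw [← List.toFinset_card_of_nodup hl, ← Set.ncard_coe_finset]
  exact Set.ncard_le_ncard (fun x hx => hs x (by simpa using hx)) (Set.toFinite s)

variable (R) in
theorem bddAbove_isSimplePath (v : V) :
    BddAbove {k | ∃ l, IsSimplePath R v l ∧ l.length = k + 1} :=
  ⟨Nat.card V, by
    rintro k ⟨l, hl, hk⟩
    have := hl.2.2.length_le_natCard
    omega⟩

theorem IsSimplePath.length_le {v : V} {l : List V} (hl : IsSimplePath R v l) :
    l.length ≤ longestPath R v + 1 := by
  rcases Nat.eq_zero_or_pos l.length with h | h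
  · omega
  · have : l.length - 1 ≤ longestPath R v :=
      le_csSup (bddAbove_isSimplePath R v) ⟨l, hl, by omega⟩
    omega

variable (R) in
theorem exists_isSimplePath_length (v : V) :
    ∃ l, IsSimplePath R v l ∧ l.length = longestPath R v + 1 :=
  Nat.sSup_mem (s := {k | ∃ l, IsSimplePath R v l ∧ l.length = k + 1})
    ⟨0, [v], by simp [IsSimplePath], rfl⟩ (bddAbove_isSimplePath R v)

/-- No node of `p` can be met again from `a`, so the tail after `p` may be replaced by a longest
simple path from `a`. -/
theorem length_add_longestPath_le {v a : V} {p t : List V} (hp : IsSimplePath R v (p ++ a :: t))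
    (hreach : ∀ x ∈ p, ¬ ReflTransGen R a x) :
    p.length + longestPath R a ≤ longestPath R v := by
  obtain ⟨l, ⟨h1, h2, h3⟩, h4⟩ := exists_isSimplePath_length R a
  obtain ⟨g1, g2, g3⟩ := hp
  have hs : IsSimplePath R v (p ++ l) := by
    refine ⟨?_, ?_, ?_⟩
    · cases p <;> simp_all
    · rw [List.isChain_append] at g2 ⊢
      exact ⟨g2.1, h2, fun x hx y hy => g2.2.2 x hx y (by simp_all)⟩
    · rw [List.nodup_append] at g3 ⊢
      refine ⟨g3.1, h3, fun x hx y hy hxy => hreach x hx ?_⟩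
      exact hxy ▸ h2.reflTransGen_of_mem h1 hy
  have := hs.length_le
  simp only [List.length_append] at this
  omega

/-- A longest path from `w` starts with at most `ncard` nodes of the component and, having left it,
never returns. Replacing this initial part by a simple path from `a` to its last node gives a simple
path from `a`. -/
theorem longestPath_le_add_ncard {a w : V} (hw : w ∈ stronglyConnectedComponent R a) :
    longestPath R w ≤ longestPath R a + (stronglyConnectedComponent R a).ncard := by
  classical
  obtain ⟨q, ⟨h1, h2, h3⟩, h4⟩ := exists_isSimplePath_length R w
  set C := stronglyConnectedComponent R a with hC
  let s := q.takeWhile (fun x => decide (x ∈ C))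
  let t := q.dropWhile (fun x => decide (x ∈ C))
  have hst : s ++ t = q := List.takeWhile_append_dropWhile
  have hsC : ∀ x ∈ s, x ∈ C := fun x hx => by simpa using List.mem_takeWhile_imp hx
  have hws : s.head? = some w := by
    cases q with
    | nil => simp at h1
    | cons b q =>
      obtain rfl : b = w := by simpa using h1
      simp [s, hw]
  have hsl : s.length ≤ C.ncard := List.Nodup.length_le_ncard
    (by rw [← hst, List.nodup_append] at h3; exact h3.1) hsC
  obtain ⟨z, hz⟩ : ∃ z, s.getLast? = some z := by
    cases hs : s with
    | nil => simp [hs] at hws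
    | cons b s => exact ⟨_, List.getLast?_eq_getLast_of_ne_nil (by simp)⟩
  have hzs : z ∈ s := List.mem_of_getLast? hz
  obtain ⟨m, ⟨m1, m2, m3⟩, m4⟩ := exists_isSimplePath_of_reflTransGen (hsC z hzs).1
  rw [← hst] at h2 h3
  have ht : ∀ y ∈ t, ReflTransGen R a y ∧ y ∉ C := by
    intro y hy
    have hay : ∀ y ∈ t, ReflTransGen R a y := fun y hy =>
      hw.1.trans (h2.reflTransGen_of_mem (a := w) (by rw [hst]; exact h1) (by simp [hy]))
    refine ⟨hay y hy, fun hyC => ?_⟩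
    cases ht : t with
    | nil => simp [ht] at hy
    | cons b t' =>
      have hb : b ∉ C := by
        have := List.head?_dropWhile_not (fun x => decide (x ∈ C)) q
        have h5 : q.dropWhile (fun x => decide (x ∈ C)) = b :: t' := ht
        rw [h5] at this
        simpa using this
      apply hb
      refine ⟨hay b (by simp [ht]), ReflTransGen.trans ?_ hyC.2⟩
      have := (List.isChain_append.1 h2).2.1
      exact this.reflTransGen_of_mem (by simp [ht]) hy
  have hs : IsSimplePath R a (m ++ t) := by
    refine ⟨?_, ?_, ?_⟩
    · cases m <;> simp_all
    · rw [List.isChain_append] at h2 ⊢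
      exact ⟨m2, h2.2.1, fun x hx y hy => h2.2.2 x (by simp_all) y hy⟩
    · rw [List.nodup_append] at h3 ⊢
      refine ⟨m3, h3.2.1, fun x hx y hy hxy => (ht y hy).2 ?_⟩
      subst hxy
      exact ⟨(ht _ hy).1, (m2.reflTransGen_getLast m4 hx).trans (hsC z hzs).2⟩
  have hml : 0 < m.length := by
    cases m with
    | nil => simp at m1
    | cons => simp
  have h5 := hs.length_le
  have h6 := congrArg List.length hst
  simp only [List.length_append] at h5 h6
  omega

/-- Split `l` at its first node `a` in the component of `u`. The part before `a` extends by a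
longest path from `a`; the part from `a` on stays in the component and costs one `ncard`; passing
from `a` to `w` costs the other. -/
theorem IsSimplePath.length_add_longestPath_le {v u w : V} {l : List V}
    (hl : IsSimplePath R v l) (hu : l.getLast? = some u)
    (hw : w ∈ stronglyConnectedComponent R u) :
    l.length + longestPath R w ≤
      longestPath R v + 2 * (stronglyConnectedComponent R u).ncard := by
  classical
  set C := stronglyConnectedComponent R u with hC
  let p := l.takeWhile (fun x => decide (x ∉ C))
  let t := l.dropWhile (fun x => decide (x ∉ C))
  have hpt : p ++ t = l := List.takeWhile_append_dropWhile
  have hpC : ∀ x ∈ p, x ∉ C := fun x hx => by simpa using List.mem_takeWhile_imp hx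
  have huC : u ∈ C := ⟨.refl, .refl⟩
  cases ht : t with
  | nil =>
    rw [ht, List.append_nil] at hpt
    exact absurd huC (hpC u (by rw [hpt]; exact List.mem_of_getLast? hu))
  | cons a t' =>
    rw [ht] at hpt
    have ha : a ∈ C := by
      have := List.head?_dropWhile_not (fun x => decide (x ∉ C)) l
      have h5 : l.dropWhile (fun x => decide (x ∉ C)) = a :: t' := ht
      rw [h5] at this
      simpa using this
    rw [← hpt] at hl hu
    have hCa := stronglyConnectedComponent_eq ha
    have hchain := List.isChain_append.1 hl.2.1
    have h1 := _root_.length_add_longestPath_le hl (fun x hx hax => hpC x hx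
      ⟨ha.1.trans hax, hl.2.1.reflTransGen_getLast hu (by simp [hx])⟩)
    have h2 := longestPath_le_add_ncard (R := R) (a := a) (w := w) (by rw [hCa]; exact hw)
    rw [hCa, ← hC] at h2
    have h3 : (a :: t').length ≤ C.ncard :=
      List.Nodup.length_le_ncard (List.nodup_append.1 hl.2.2).2.1 fun x hx =>
        ⟨ha.1.trans (hchain.2.1.reflTransGen_of_mem rfl hx),
          hl.2.1.reflTransGen_getLast hu (by simp only [List.mem_append]; exact .inr hx)⟩
    rw [← hpt, List.length_append]
    omega

end LongestPath

/-! ### Tilt relative to a line -/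

namespace OneCounterNet

/-- The signed distance, up to scaling, of the point `x` to the line spanned by `(1 - r, r)`;
it is positive below the line. -/
def tilt (r : ℚ) (x : ℤ × ℤ) : ℚ := r * (x.1 + x.2) - x.2

theorem tilt_add (r : ℚ) (x y : ℤ × ℤ) : tilt r (x + y) = tilt r x + tilt r y := by
  simp only [tilt, Prod.fst_add, Prod.snd_add]
  push_cast
  ring

theorem tilt_sub (r : ℚ) (x y : ℤ × ℤ) : tilt r (x - y) = tilt r x - tilt r y := by
  simp only [tilt, Prod.fst_sub, Prod.snd_sub]
  push_cast
  ring

/-- Both coordinates of `x` have absolute value at most `k`. -/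
def InBox (k : ℕ) (x : ℤ × ℤ) : Prop := |x.1| ≤ k ∧ |x.2| ≤ k

theorem InBox.add {k l : ℕ} {x y : ℤ × ℤ} (hx : InBox k x) (hy : InBox l y) :
    InBox (k + l) (x + y) :=
  ⟨by push_cast; exact (abs_add_le _ _).trans (add_le_add hx.1 hy.1),
    by push_cast; exact (abs_add_le _ _).trans (add_le_add hx.2 hy.2)⟩

theorem InBox.mono {k l : ℕ} {x : ℤ × ℤ} (hx : InBox k x) (h : k ≤ l) : InBox l x :=
  ⟨hx.1.trans (by exact_mod_cast h), hx.2.trans (by exact_mod_cast h)⟩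

theorem inBox_zero (k : ℕ) : InBox k 0 := by simp [InBox]

theorem InBox.abs_tilt_le {k : ℕ} {x : ℤ × ℤ} (hx : InBox k x) {r : ℚ} (h0 : 0 ≤ r)
    (h1 : r ≤ 1) : |tilt r x| ≤ k := by
  obtain ⟨⟨a, b⟩, ⟨c, d⟩⟩ := And.imp abs_le.1 abs_le.1 hx
  have a' : (-k : ℚ) ≤ x.1 := by exact_mod_cast a
  have b' : (x.1 : ℚ) ≤ k := by exact_mod_cast b
  have c' : (-k : ℚ) ≤ x.2 := by exact_mod_cast c
  have d' : (x.2 : ℚ) ≤ k := by exact_mod_cast d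
  have h1' : 0 ≤ 1 - r := by linarith
  rw [abs_le, tilt]
  constructor
  · linarith [mul_le_mul_of_nonneg_left a' h0, mul_le_mul_of_nonneg_left d' h1']
  · linarith [mul_le_mul_of_nonneg_left b' h0, mul_le_mul_of_nonneg_left c' h1']

theorem tilt_mono {r s : ℚ} (h : r ≤ s) {x : ℤ × ℤ} (hx : 0 ≤ x) : tilt r x ≤ tilt s x := by
  have h1 : (0 : ℚ) ≤ x.1 + x.2 := by exact_mod_cast add_nonneg hx.1 hx.2
  simp only [tilt]
  linarith [mul_le_mul_of_nonneg_right h h1]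

/-- Below the line Spoiler can fire any transition; `pos_snd_of_tilt_neg` is the counterpart for
Duplicator above it. -/
theorem pos_fst_of_tilt_pos {r : ℚ} (h1 : r ≤ 1) {n n' : ℕ}
    (h : 0 < tilt r ((n : ℤ), (n' : ℤ))) : 0 < n := by
  rcases Nat.eq_zero_or_pos n with rfl | hn
  · have h2 : (0 : ℚ) ≤ n' := n'.cast_nonneg
    simp only [tilt] at h
    push_cast at h
    linarith [mul_nonneg (sub_nonneg.2 h1) h2]
  · exact hn

theorem pos_snd_of_tilt_neg {r : ℚ} (h0 : 0 ≤ r) {n : ℕ} {n' : ℕ}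
    (h : tilt r ((n : ℤ), (n' : ℤ)) < 0) : 0 < n' := by
  rcases Nat.eq_zero_or_pos n' with rfl | hn
  · have h2 : (0 : ℚ) ≤ n := n.cast_nonneg
    simp only [tilt] at h
    push_cast at h
    linarith [mul_nonneg h0 h2]
  · exact hn

theorem snd_neg_of_tilt_pos {r : ℚ} (h0 : 0 ≤ r) (h1 : r ≤ 1) {x : ℤ × ℤ}
    (h : 0 < tilt r x) (hx : ¬ 0 ≤ x) : x.2 < 0 := by
  by_contra! h2
  have h3 : x.1 < 0 := by
    by_contra! h3
    exact hx ⟨h3, h2⟩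
  have h2' : (0 : ℚ) ≤ x.2 := by exact_mod_cast h2
  have h3' : (x.1 : ℚ) ≤ 0 := by exact_mod_cast h3.le
  simp only [tilt] at h
  linarith [mul_nonneg h0 (neg_nonneg.2 h3'), mul_nonneg (sub_nonneg.2 h1) h2']

variable {Q : Type u} {Q' : Type v} {A : Type w} (N : OneCounterNet Q A) (N' : OneCounterNet Q' A)

/-! ### Bounds on the parameters of the product graph -/

section Measures

variable [Finite Q] [Finite Q']

theorem ncard_stronglyConnectedComponent_le (x : Q × Q') :
    (stronglyConnectedComponent (ProductAdj N N') x).ncard ≤ scc N N' :=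
  le_ciSup (f := fun x => (component N N' x).ncard) (Set.toFinite _).bddAbove x

theorem longestPath_le_acyc (x : Q × Q') : longestPath (ProductAdj N N') x ≤ acyc N N' := by
  obtain ⟨l, ⟨_, h2, h3⟩, h4⟩ := exists_isSimplePath_length (ProductAdj N N') x
  refine le_csSup ⟨Nat.card (Q × Q'), ?_⟩ ⟨fun i => l.get (i.cast h4.symm), ?_, fun i => ?_⟩
  · rintro k ⟨π, hπ, -⟩
    have := Nat.card_le_card_of_injective π hπ
    simp only [Nat.card_fin] at this
    omega
  · intro i j hij
    have := List.nodup_iff_injective_get.1 h3 hij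
    simpa [Fin.ext_iff] using this
  · have := List.isChain_iff_getElem.1 h2 i (by omega)
    simpa using this

theorem acyc_le : acyc N N' ≤ Nat.card Q * Nat.card Q' := by
  rw [← Nat.card_prod]
  refine csSup_le' ?_
  rintro k ⟨π, hπ, -⟩
  have := Nat.card_le_card_of_injective π hπ
  simp only [Nat.card_fin] at this
  omega

theorem scc_le : scc N N' ≤ Nat.card Q * Nat.card Q' := by
  rw [← Nat.card_prod, ← Set.ncard_univ]
  exact ciSup_le' fun x => Set.ncard_le_ncard (Set.subset_univ _) (Set.toFinite _)

end Measures

/-! ### Simple paths with their effects -/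

/-- A node of the product control graph together with the effect of the path leading to it. -/
abbrev Visit (Q : Type u) (Q' : Type v) := (Q × Q') × (ℤ × ℤ)

/-- The visit `y` results from `x` by following an edge of the product control graph. -/
def Move (x y : Visit Q Q') : Prop :=
  ∃ l, ProductEdge N N' x.1 l y.1 ∧ y.2 = x.2 + ((l.2.1 : ℤ), (l.2.2 : ℤ))

/-- `h` lists, most recent first, the visits along a path without repeated nodes from `v`. -/
structure IsHistory (v : Q × Q') (h : List (Visit Q Q')) : Prop where
  chain : h.IsChain (fun y x => Move N N' x y)
  nodup : (h.map Prod.fst).Nodup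
  getLast : h.getLast? = some (v, 0)

variable {N N'}

theorem Move.productAdj {x y : Visit Q Q'} (h : Move N N' x y) : ProductAdj N N' x.1 y.1 :=
  let ⟨l, hl, _⟩ := h
  ⟨l, hl⟩

theorem Move.inBox {x y : Visit Q Q'} (h : Move N N' x y) : InBox 1 (y.2 - x.2) := by
  obtain ⟨⟨a, d, d'⟩, -, h⟩ := h
  rw [h, add_sub_cancel_left]
  constructor <;> [cases d; cases d'] <;> simp

variable (N N') in
theorem isHistory_singleton (v : Q × Q') : IsHistory N N' v [(v, 0)] :=
  ⟨by simp, by simp, rfl⟩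

theorem IsHistory.of_suffix {v : Q × Q'} {h t : List (Visit Q Q')} (hh : IsHistory N N' v h)
    (ht : t <:+ h) (hne : t ≠ []) : IsHistory N N' v t := by
  obtain ⟨s, rfl⟩ := ht
  obtain ⟨h1, h2, h3⟩ := hh
  refine ⟨(List.isChain_append.1 h1).2.1, ?_, ?_⟩
  · rw [List.map_append, List.nodup_append] at h2
    exact h2.2.1
  · rwa [List.getLast?_append_of_ne_nil _ hne] at h3

theorem IsHistory.cons {v : Q × Q'} {x y : Visit Q Q'} {h : List (Visit Q Q')}
    (hh : IsHistory N N' v (x :: h)) (hxy : Move N N' x y)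
    (hy : ∀ e, (y.1, e) ∉ x :: h) : IsHistory N N' v (y :: x :: h) := by
  obtain ⟨h1, h2, h3⟩ := hh
  refine ⟨List.isChain_cons_cons.2 ⟨hxy, h1⟩, ?_, by simpa using h3⟩
  rw [List.map_cons, List.nodup_cons]
  refine ⟨fun hm => ?_, h2⟩
  obtain ⟨z, hz, hzy⟩ := List.mem_map.1 hm
  exact hy z.2 (by rw [← hzy]; exact hz)

theorem inBox_sub_of_isChain {x y : Visit Q Q'} {s t : List (Visit Q Q')}
    (h : (x :: s ++ y :: t).IsChain (fun y x => Move N N' x y)) :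
    InBox (s.length + 1) (x.2 - y.2) := by
  induction s generalizing x with
  | nil =>
    simp only [List.cons_append, List.nil_append, List.isChain_cons_cons] at h
    simpa using h.1.inBox
  | cons z s ih =>
    simp only [List.cons_append, List.isChain_cons_cons] at h
    have := (ih h.2).add h.1.inBox
    simpa using this

theorem IsHistory.inBox {v : Q × Q'} {x : Visit Q Q'} {h : List (Visit Q Q')}
    (hh : IsHistory N N' v (x :: h)) : InBox h.length x.2 := by
  obtain ⟨h1, -, h3⟩ := hh
  rcases List.eq_nil_or_concat h with rfl | ⟨s, y, rfl⟩
  · obtain rfl : x = (v, 0) := by simpa using h3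
    exact inBox_zero _
  · rw [List.concat_eq_append, ← List.cons_append] at h1 h3
    obtain rfl : y = (v, 0) := by simpa only [List.getLast?_concat, Option.some.injEq] using h3
    have := inBox_sub_of_isChain h1
    simpa using this

theorem IsHistory.isSimplePath {v : Q × Q'} {h : List (Visit Q Q')} (hh : IsHistory N N' v h) :
    IsSimplePath (ProductAdj N N') v (h.map Prod.fst).reverse := by
  refine ⟨?_, ?_, List.nodup_reverse.2 hh.nodup⟩
  · simp [hh.getLast]
  · rw [List.isChain_reverse, List.isChain_map]
    exact hh.chain.imp fun _ _ h => h.productAdj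

theorem IsHistory.reflTransGen_of_mem {v : Q × Q'} {x y : Visit Q Q'} {h : List (Visit Q Q')}
    (hh : IsHistory N N' v (x :: h)) (hy : y ∈ x :: h) :
    ReflTransGen (ProductAdj N N') y.1 x.1 :=
  hh.isSimplePath.2.1.reflTransGen_getLast (by simp) (by
    rw [List.mem_reverse]
    exact List.mem_map_of_mem hy)

variable [Finite Q] [Finite Q']

theorem IsHistory.length_le {v : Q × Q'} {x : Visit Q Q'} {h : List (Visit Q Q')}
    (hh : IsHistory N N' v (x :: h)) : h.length ≤ longestPath (ProductAdj N N') v := by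
  simpa using hh.isSimplePath.length_le

/-- When a cycle closes at `w`, the current node lies in the component of `w`. This is the price of
restarting the game at `w`; the summand 1 is the closing edge. -/
theorem IsHistory.length_add_longestPath_le {v w : Q × Q'} {x : Visit Q Q'} {e e' : ℤ × ℤ}
    {h : List (Visit Q Q')} (hh : IsHistory N N' v (x :: h)) (hw : Move N N' x (w, e'))
    (hm : (w, e) ∈ x :: h) :
    h.length + 1 + longestPath (ProductAdj N N') w ≤
      longestPath (ProductAdj N N') v + 2 * scc N N' := by
  have h1 := hh.isSimplePath.length_add_longestPath_le (u := x.1) (w := w) (by simp)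
    ⟨.single hw.productAdj, hh.reflTransGen_of_mem hm⟩
  have h2 := ncard_stronglyConnectedComponent_le N N' x.1
  simp only [List.length_reverse, List.length_map, List.length_cons] at h1
  omega

/-- The effect of a cycle is bounded by the size of its strongly connected component. -/
theorem IsHistory.inBox_sub {v w : Q × Q'} {x : Visit Q Q'} {e e' : ℤ × ℤ}
    {h : List (Visit Q Q')} (hh : IsHistory N N' v (x :: h)) (hw : Move N N' x (w, e'))
    (hm : (w, e) ∈ x :: h) : InBox (scc N N') (e' - e) := by
  obtain ⟨s, t, hst⟩ := List.append_of_mem hm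
  have hhst := hh
  rw [hst] at hhst
  have hC : ∀ y ∈ (s ++ [(w, e)]).map Prod.fst,
      y ∈ stronglyConnectedComponent (ProductAdj N N') w := by
    intro y hy
    obtain ⟨z, hz, rfl⟩ := List.mem_map.1 hy
    have hzx : ReflTransGen (ProductAdj N N') z.1 x.1 := hh.reflTransGen_of_mem (by
      rw [hst]
      simp only [List.mem_append, List.mem_cons, List.not_mem_nil, or_false] at hz ⊢
      tauto)
    refine ⟨?_, hzx.tail hw.productAdj⟩
    obtain ⟨s₁, s₂, hs⟩ := List.append_of_mem hz
    have hsuf : z :: (s₂ ++ t) <:+ x :: h := ⟨s₁, by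
      rw [hst, ← List.singleton_append (l := t) (x := (w, e)), ← List.append_assoc, hs]
      simp⟩
    refine (hh.of_suffix hsuf (by simp)).reflTransGen_of_mem (y := (w, e)) ?_
    rcases List.eq_nil_or_concat s₂ with rfl | ⟨s₃, y, rfl⟩
    · have := List.append_inj_right' hs (by simp)
      simp_all
    · have h5 : s ++ [(w, e)] = (s₁ ++ z :: s₃) ++ [y] := by simpa using hs
      have := List.append_inj_right' h5 (by simp)
      simp_all
  have hnd : ((s ++ [(w, e)]).map Prod.fst).Nodup := by
    have := hhst.nodup
    rw [← List.singleton_append (l := t) (x := (w, e)), ← List.append_assoc, List.map_append,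
      List.nodup_append] at this
    exact this.1
  have hlen := (hnd.length_le_ncard hC).trans (ncard_stronglyConnectedComponent_le N N' w)
  simp only [List.length_map, List.length_append, List.length_singleton] at hlen
  have hchain : ((w, e') :: s ++ (w, e) :: t).IsChain (fun y x => Move N N' x y) := by
    have h1 : ((w, e') :: x :: h).IsChain (fun y x => Move N N' x y) :=
      List.isChain_cons_cons.2 ⟨hw, hh.chain⟩
    rwa [hst] at h1
  exact (inBox_sub_of_isChain hchain).mono hlen

end OneCounterNet

/-! ### The slope game -/

namespace OneCounterNet

variable {Q : Type u} {Q' : Type v} {A : Type w} (N : OneCounterNet Q A) (N' : OneCounterNet Q' A)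

/-- In the game in which both players extend the path `h` in the product control graph until a
cycle is closed, Spoiler can force that Duplicator gets stuck or that the node `w` where the cycle
is closed and the effect `α` of the cycle satisfy `good w α`. -/
inductive SpoilerForces (good : Q × Q' → ℤ × ℤ → Prop) : List (Visit Q Q') → Prop
  | move {x : Visit Q Q'} {h : List (Visit Q Q')} (a : A) (d : SignType) (q : Q)
      (step : (x.1.1, a, d, q) ∈ N.trans)
      (extend : ∀ d' q', (x.1.2, a, d', q') ∈ N'.trans → (∀ e, ((q, q'), e) ∉ x :: h) →
        SpoilerForces good (((q, q'), x.2 + ((d : ℤ), (d' : ℤ))) :: x :: h))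
      (close : ∀ d' q', (x.1.2, a, d', q') ∈ N'.trans → ∀ e, ((q, q'), e) ∈ x :: h →
        good (q, q') (x.2 + ((d : ℤ), (d' : ℤ)) - e)) :
      SpoilerForces good (x :: h)

/-- The cycle effects by which Spoiler makes progress at slope `r`, provided that positive cycles
are closed in nodes satisfying `W`. -/
def Progress (r : ℚ) (W : Q × Q' → Prop) (w : Q × Q') (α : ℤ × ℤ) : Prop :=
  0 < tilt r α ∧ (0 ≤ α → W w)

/-- Spoiler wins the slope game from `v` at all slopes `r i` with `i < j`, where closing a positive
cycle lowers the slope by one step. -/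
def SpoilerWins (r : ℕ → ℚ) : ℕ → Q × Q' → Prop
  | 0, _ => False
  | j + 1, v => SpoilerForces N N' (Progress (r j) (SpoilerWins r j)) [(v, 0)]

/-- The distance to the line at which the winner of the slope game wins the simulation game. -/
noncomputable def margin (v : Q × Q') (j : ℕ) : ℕ :=
  longestPath (ProductAdj N N') v + j * (2 * scc N N')

variable {N N'}

theorem exists_response_of_not_spoilerForces {good : Q × Q' → ℤ × ℤ → Prop} {x : Visit Q Q'}
    {h : List (Visit Q Q')} (hx : ¬ SpoilerForces N N' good (x :: h)) {a : A} {d : SignType}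
    {q : Q} (hstep : (x.1.1, a, d, q) ∈ N.trans) :
    ∃ d' q', (x.1.2, a, d', q') ∈ N'.trans ∧
      (((∀ e, ((q, q'), e) ∉ x :: h) ∧
          ¬ SpoilerForces N N' good (((q, q'), x.2 + ((d : ℤ), (d' : ℤ))) :: x :: h)) ∨
        ∃ e, ((q, q'), e) ∈ x :: h ∧ ¬ good (q, q') (x.2 + ((d : ℤ), (d' : ℤ)) - e)) := by
  by_contra! hc
  exact hx (.move a d q hstep (fun d' q' ht => (hc d' q' ht).1) (fun d' q' ht => (hc d' q' ht).2))

theorem neg_one_le_signType (d : SignType) : -1 ≤ (d : ℤ) := by cases d <;> simp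

theorem exists_counter {n : ℕ} (hn : 0 < n) (d : SignType) :
    ∃ m : ℕ, (m : ℤ) = (n : ℤ) + (d : ℤ) :=
  ⟨((n : ℤ) + d).toNat, Int.toNat_of_nonneg (by have := neg_one_le_signType d; omega)⟩

theorem suffix_cons_forall {P : List (Visit Q Q') → Prop} {x : Visit Q Q'}
    {h : List (Visit Q Q')} (hx : P (x :: h)) (hh : ∀ t, t <:+ h → t ≠ [] → P t) :
    ∀ t, t <:+ x :: h → t ≠ [] → P t := by
  intro t ht hne
  rcases List.suffix_cons_iff.1 ht with rfl | ht
  · exact hx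
  · exact hh t ht hne

/-! ### Duplicator's strategy -/

/-- The configurations `(q, n)`, `(q', n')` are reached along a history all of whose prefixes are
won by Duplicator in the slope game, from a point far above the line of slope `r j`. -/
def DuplicatorInvariant (N : OneCounterNet Q A) (N' : OneCounterNet Q' A) (r : ℕ → ℚ)
    (c : Q × ℕ) (c' : Q' × ℕ) : Prop :=
  ∃ j v e h, IsHistory N N' v (((c.1, c'.1), e) :: h) ∧
    (∀ t, t <:+ ((c.1, c'.1), e) :: h → t ≠ [] →
      ¬ SpoilerForces N N' (Progress (r j) (SpoilerWins N N' r j)) t) ∧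
    tilt (r j) (((c.2 : ℤ), (c'.2 : ℤ)) - e) < -(margin N N' v j : ℚ)

theorem duplicatorInvariant_of_not_spoilerWins {r : ℕ → ℚ} {j : ℕ} {q : Q} {q' : Q'} {n n' : ℕ}
    (hw : ¬ SpoilerWins N N' r (j + 1) (q, q'))
    (hx : tilt (r j) ((n : ℤ), (n' : ℤ)) < -(margin N N' (q, q') j : ℚ)) :
    DuplicatorInvariant N N' r (q, n) (q', n') :=
  ⟨j, (q, q'), 0, [], isHistory_singleton N N' _,
    suffix_cons_forall hw (fun t ht hne => absurd (List.suffix_nil.1 ht) hne), by simpa using hx⟩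

variable [Finite Q] [Finite Q']

theorem isSimulation_duplicatorInvariant {r : ℕ → ℚ} (hmono : Monotone r) (hr0 : r 0 = 0)
    (hr1 : ∀ j, r j ≤ 1) :
    IsSimulation N.Step N'.Step (DuplicatorInvariant N N' r) := by
  have hr : ∀ j, 0 ≤ r j := fun j => hr0 ▸ hmono j.zero_le
  rintro ⟨q, n⟩ ⟨q', n'⟩ ⟨j, v, e, h, hh, hD, ht⟩ a ⟨p, m⟩ ⟨d, hd, hm⟩
  dsimp only at hh hD ht hd hm
  have hlen := hh.length_le
  have he := abs_le.1 (hh.inBox.abs_tilt_le (hr j) (hr1 j))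
  have hx : tilt (r j) ((n : ℤ), (n' : ℤ)) < -(margin N N' v j : ℚ) + h.length := by
    rw [tilt_sub] at ht
    linarith [he.2]
  have hx0 : tilt (r j) ((n : ℤ), (n' : ℤ)) < 0 := by
    have : (h.length : ℚ) ≤ margin N N' v j := by
      exact_mod_cast hlen.trans (Nat.le_add_right _ _)
    linarith
  obtain ⟨d', p', hd', hres⟩ := exists_response_of_not_spoilerForces
    (hD _ List.suffix_rfl (by simp)) hd
  obtain ⟨m', hm'⟩ := exists_counter (pos_snd_of_tilt_neg (hr j) hx0) d'
  refine ⟨(p', m'), ⟨d', hd', hm'⟩, ?_⟩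
  have hmm : ((m : ℤ), (m' : ℤ)) = ((n : ℤ), (n' : ℤ)) + ((d : ℤ), (d' : ℤ)) := by
    rw [hm, hm']; rfl
  have hmove : Move N N' ((q, q'), e) ((p, p'), e + ((d : ℤ), (d' : ℤ))) :=
    ⟨(a, d, d'), ⟨hd, hd'⟩, rfl⟩
  rcases hres with ⟨hnew, hF⟩ | ⟨e₀, he₀, hgood⟩
  · refine ⟨j, v, _, _, hh.cons hmove hnew, suffix_cons_forall hF hD, ?_⟩
    dsimp only
    rwa [hmm, add_sub_add_right_eq_sub]
  · by_cases hpos : 0 < tilt (r j) (e + ((d : ℤ), (d' : ℤ)) - e₀)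
    · simp only [Progress, hpos, true_and, Classical.not_imp] at hgood
      obtain ⟨hα, hW⟩ := hgood
      -- At slope 0 the tilt is minus the second coordinate, so a nonnegative cycle never has
      -- positive tilt and a lower slope always exists. On the quadrant, lowering the slope only
      -- lowers the tilt.
      cases j with
      | zero =>
        have h2 : (0 : ℚ) ≤ ((e + ((d : ℤ), (d' : ℤ)) - e₀).2 : ℤ) := by exact_mod_cast hα.2
        rw [tilt, hr0] at hpos
        linarith
      | succ j =>
        refine duplicatorInvariant_of_not_spoilerWins hW ?_
        have h1 : tilt (r j) ((n : ℤ), (n' : ℤ)) ≤ tilt (r (j + 1)) ((n : ℤ), (n' : ℤ)) :=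
          tilt_mono (hmono j.le_succ) ⟨by simp, by simp⟩
        have h2 := hmove.inBox
        rw [add_sub_cancel_left] at h2
        have h3 := (abs_le.1 (h2.abs_tilt_le (hr j) (hr1 j))).2
        have h4 := hh.length_add_longestPath_le hmove he₀
        have h5 : (h.length : ℚ) + 1 + margin N N' (p, p') j ≤ margin N N' v (j + 1) := by
          norm_cast
          simp only [margin]
          linarith
        rw [hmm, tilt_add]
        push_cast at h3
        linarith
    -- The cycle is cut out: its effect, of nonpositive tilt, moves into the base point, and play
    -- resumes from the earlier visit.
    · obtain ⟨s, t, hst⟩ := List.append_of_mem he₀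
      have hsuf : ((p, p'), e₀) :: t <:+ ((q, q'), e) :: h := ⟨s, hst.symm⟩
      refine ⟨j, v, e₀, t, hh.of_suffix hsuf (by simp),
        fun t' ht' hne => hD t' (ht'.trans hsuf) hne, ?_⟩
      dsimp only
      have : ((m : ℤ), (m' : ℤ)) - e₀ =
          (((n : ℤ), (n' : ℤ)) - e) + (e + ((d : ℤ), (d' : ℤ)) - e₀) := by rw [hmm]; abel
      rw [this, tilt_add]
      linarith

theorem sim_of_not_spoilerWins {r : ℕ → ℚ} (hmono : Monotone r) (hr0 : r 0 = 0)
    (hr1 : ∀ j, r j ≤ 1) {j : ℕ} {q : Q} {q' : Q'} {n n' : ℕ}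
    (hw : ¬ SpoilerWins N N' r (j + 1) (q, q'))
    (hx : tilt (r j) ((n : ℤ), (n' : ℤ)) < -(margin N N' (q, q') j : ℚ)) :
    N.Sim N' q n q' n' :=
  ⟨_, isSimulation_duplicatorInvariant hmono hr0 hr1,
    duplicatorInvariant_of_not_spoilerWins hw hx⟩

/-! ### Spoiler's strategy -/

/-- An integer multiple of the tilt. -/
def intTilt (r : ℚ) (x : ℤ × ℤ) : ℤ := r.num * (x.1 + x.2) - r.den * x.2

theorem intTilt_eq (r : ℚ) (x : ℤ × ℤ) : (intTilt r x : ℚ) = r.den * tilt r x := by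
  have h : (r.den : ℚ) * r = r.num := by exact_mod_cast Rat.den_mul_eq_num r
  simp only [intTilt, tilt]
  push_cast
  rw [← h]
  ring

theorem intTilt_add (r : ℚ) (x y : ℤ × ℤ) : intTilt r (x + y) = intTilt r x + intTilt r y := by
  simp only [intTilt, Prod.fst_add, Prod.snd_add]
  ring

theorem intTilt_pos {r : ℚ} {x : ℤ × ℤ} : 0 < intTilt r x ↔ 0 < tilt r x := by
  rw [← Int.cast_pos (R := ℚ), intTilt_eq]
  exact mul_pos_iff_of_pos_left (by exact_mod_cast r.den_pos)

theorem not_sim_of_spoilerWins {r : ℕ → ℚ} (hmono : Monotone r) (hr0 : r 0 = 0)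
    (hr1 : ∀ j, r j ≤ 1)
    (hbox : ∀ j α, InBox (scc N N') α → 0 < tilt (r j) α → 0 ≤ tilt (r (j + 1)) α)
    {j : ℕ} {v : Q × Q'} {n n' : ℕ} (hw : SpoilerWins N N' r j v)
    (hx : (margin N N' v j : ℚ) < tilt (r j) ((n : ℤ), (n' : ℤ))) :
    ¬ N.Sim N' v.1 n v.2 n' := by
  have hr : ∀ j, 0 ≤ r j := fun j => hr0 ▸ hmono j.zero_le
  induction j generalizing v n n' with
  | zero => exact hw.elim
  | succ j ihj =>
    set T := margin N N' v (j + 1) with hT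
    set G := Progress (r j) (SpoilerWins N N' r j) with hG
    have hlenT : longestPath (ProductAdj N N') v ≤ T := Nat.le_add_right _ _
    -- Lexicographic induction for the base point `b`: `k` measures how far `b` is from passing the
    -- threshold at `r j`, `l` bounds what is left of Duplicator's counter, and the innermost
    -- induction runs along `SpoilerForces`. The integral tilt makes each cycle count by at least 1.
    suffices H : ∀ k l : ℕ, ∀ b : ℤ × ℤ, ((r j).den * T + 1 - intTilt (r j) b).toNat = k →
        (b.2 + T + 2).toNat = l → (T : ℚ) < tilt (r (j + 1)) b →
        ∀ h, SpoilerForces N N' G h → IsHistory N N' v h →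
        (∀ t, t <:+ h → t ≠ [] → SpoilerForces N N' G t) →
        ∀ (y : Visit Q Q') (t : List (Visit Q Q')) (n n' : ℕ), h = y :: t →
        ((n : ℤ), (n' : ℤ)) = b + y.2 → ¬ N.Sim N' y.1.1 n y.1.2 n' from
      H _ _ ((n : ℤ), (n' : ℤ)) rfl rfl hx _ hw (isHistory_singleton N N' v)
        (suffix_cons_forall hw (fun t ht hne => absurd (List.suffix_nil.1 ht) hne))
        (v, 0) [] n n' rfl (by simp)
    intro k
    induction k using Nat.strong_induction_on with
    | _ k ihk =>
    intro l
    induction l using Nat.strong_induction_on with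
    | _ l ihl =>
    intro b hk hl hb h hF
    induction hF with
    | @move x h a d q hstep hext hclose ihF =>
    intro hh hS y t n n' hy hnb hsim
    obtain ⟨rfl, rfl⟩ := List.cons.inj hy
    have hlen := hh.length_le
    have hlenT' : (h.length : ℚ) ≤ T := by exact_mod_cast hlen.trans hlenT
    have he := abs_le.1 (hh.inBox.abs_tilt_le (hr (j + 1)) (hr1 (j + 1)))
    have hx0 : 0 < tilt (r (j + 1)) ((n : ℤ), (n' : ℤ)) := by
      rw [hnb, tilt_add]
      linarith [he.1]
    obtain ⟨m, hm⟩ := exists_counter (pos_fst_of_tilt_pos (hr1 _) hx0) d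
    obtain ⟨R, hR, hRx⟩ := hsim
    obtain ⟨⟨q', m'⟩, ⟨d', hd', hm'⟩, hRy⟩ := hR _ _ hRx a (q, m) ⟨d, hstep, hm⟩
    dsimp only at hd' hm'
    have hsim' : N.Sim N' q m q' m' := ⟨R, hR, hRy⟩
    have hmm : ((m : ℤ), (m' : ℤ)) = b + (x.2 + ((d : ℤ), (d' : ℤ))) := by
      rw [← add_assoc, ← hnb, hm, hm']; rfl
    have hmove : Move N N' x ((q, q'), x.2 + ((d : ℤ), (d' : ℤ))) :=
      ⟨(a, d, d'), ⟨hstep, hd'⟩, rfl⟩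
    by_cases hnew : ∀ e, ((q, q'), e) ∉ x :: h
    · exact ihF d' q' hd' hnew (hh.cons hmove hnew)
        (suffix_cons_forall (hext d' q' hd' hnew) hS) _ _ m m' rfl hmm hsim'
    · push Not at hnew
      obtain ⟨e₀, he₀⟩ := hnew
      obtain ⟨hα, hαW⟩ := hclose d' q' hd' e₀ he₀
      have hαbox := hh.inBox_sub hmove he₀
      set α := x.2 + ((d : ℤ), (d' : ℤ)) - e₀ with hαdef
      have hα' := intTilt_pos.2 hα
      -- Beyond the threshold at `r j`, a nonnegative cycle hands over to the strategy for the lower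
      -- slope. Otherwise the cycle is cut out: before the threshold `k` drops; beyond it `k` stays
      -- 0 and `α.2 < 0`, so `l` drops.
      by_cases hswitch : 0 ≤ α ∧ (T : ℚ) < tilt (r j) b
      · refine ihj (v := (q, q')) (hαW hswitch.1) ?_ hsim'
        have h1 := abs_le.1 ((hh.inBox.add hmove.inBox).abs_tilt_le (hr j) (hr1 j))
        have h4 := hh.length_add_longestPath_le hmove he₀
        have h5 : (h.length : ℚ) + 1 + margin N N' (q, q') j ≤ T := by
          rw [hT]
          norm_cast
          simp only [margin]
          linarith
        rw [add_sub_cancel] at h1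
        push_cast at h1
        rw [hmm, tilt_add]
        linarith [h1.1, hswitch.2]
      · obtain ⟨s, t, hst⟩ := List.append_of_mem he₀
        have hsuf : ((q, q'), e₀) :: t <:+ x :: h := ⟨s, hst.symm⟩
        have hh' := hh.of_suffix hsuf (by simp)
        have hS' : ∀ t', t' <:+ ((q, q'), e₀) :: t → t' ≠ [] → SpoilerForces N N' G t' :=
          fun t' ht' hne => hS t' (ht'.trans hsuf) hne
        have hb' : (T : ℚ) < tilt (r (j + 1)) (b + α) := by
          rw [tilt_add]
          linarith [hbox j α hαbox hα]
        have hmm' : ((m : ℤ), (m' : ℤ)) = b + α + e₀ := by rw [hmm, hαdef]; abel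
        have hadd := intTilt_add (r j) b α
        by_cases hlow : tilt (r j) b ≤ T
        · have h1 : intTilt (r j) b ≤ (r j).den * T := by
            have : (intTilt (r j) b : ℚ) ≤ (r j).den * T := by
              rw [intTilt_eq]
              exact mul_le_mul_of_nonneg_left hlow (Nat.cast_nonneg _)
            exact_mod_cast this
          exact ihk _ (by rw [← hk, hadd]; omega) _ _ rfl rfl hb' _
            (hS' _ List.suffix_rfl (by simp)) hh' hS' _ _ m m' rfl hmm' hsim'
        · rw [not_le] at hlow
          have h1 : (r j).den * T + 1 ≤ intTilt (r j) b := by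
            have : ((r j).den * T : ℚ) < intTilt (r j) b := by
              rw [intTilt_eq]
              exact mul_lt_mul_of_pos_left hlow (by exact_mod_cast (r j).den_pos)
            have h' : ((r j).den * T : ℤ) < intTilt (r j) b := by exact_mod_cast this
            exact h'
          have h2 : α.2 < 0 :=
            snd_neg_of_tilt_pos (hr j) (hr1 j) hα fun h => hswitch ⟨h, hlow⟩
          have h3 : (m' : ℤ) = b.2 + α.2 + e₀.2 := congrArg Prod.snd hmm'
          have h4 := (abs_le.1 hh'.inBox.2).2
          have h5 := hh'.length_le
          dsimp only at h4
          exact ihl _ (by rw [← hl, Prod.snd_add]; omega) _ (by rw [← hk, hadd]; omega) rfl hb' _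
            (hS' _ List.suffix_rfl (by simp)) hh' hS' _ _ m m' rfl hmm' hsim'

end OneCounterNet

/-! ### The finite set of relevant slopes -/

/-- The slopes `b / (a + b)` of the nonnegative vectors `(a, b)` with entries at most `k`. -/
def boxSlopes (k : ℕ) : Finset ℚ :=
  (Finset.range (k + 1) ×ˢ Finset.range (k + 1)).image fun p => (p.2 : ℚ) / (p.1 + p.2)

theorem mem_boxSlopes {k : ℕ} {x : ℚ} :
    x ∈ boxSlopes k ↔ ∃ a b : ℕ, a ≤ k ∧ b ≤ k ∧ (b : ℚ) / (a + b) = x := by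
  simp [boxSlopes, and_assoc]

theorem card_boxSlopes_le (k : ℕ) : (boxSlopes k).card ≤ (k + 1) * (k + 1) :=
  Finset.card_image_le.trans (by simp)

theorem zero_mem_boxSlopes (k : ℕ) : 0 ∈ boxSlopes k := mem_boxSlopes.2 ⟨0, 0, by simp⟩

theorem one_mem_boxSlopes {k : ℕ} (hk : 0 < k) : 1 ∈ boxSlopes k :=
  mem_boxSlopes.2 ⟨0, 1, by simp; omega⟩

theorem boxSlopes_mem_Icc {k : ℕ} {x : ℚ} (hx : x ∈ boxSlopes k) : 0 ≤ x ∧ x ≤ 1 := by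
  obtain ⟨a, b, -, -, rfl⟩ := mem_boxSlopes.1 hx
  exact ⟨by positivity, div_le_one_of_le₀ (by simp) (by positivity)⟩

theorem den_le_of_mem_boxSlopes {k : ℕ} {x : ℚ} (hx : x ∈ boxSlopes k) : x.den ≤ 2 * k + 1 := by
  obtain ⟨a, b, ha, hb, rfl⟩ := mem_boxSlopes.1 hx
  rcases Nat.eq_zero_or_pos (a + b) with h | h
  · have h1 : a = 0 := by omega
    have h2 : b = 0 := by omega
    subst h1 h2
    simp
  · have h1 : (((b : ℚ) / (a + b)).den : ℤ) ∣ ((a + b : ℕ) : ℤ) := by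
      have := Rat.den_dvd (b : ℤ) ((a + b : ℕ) : ℤ)
      rw [Rat.divInt_eq_div] at this
      simpa using this
    have h2 := Nat.le_of_dvd h (Int.natCast_dvd_natCast.1 h1)
    omega

/-- An enumeration of a finite set of numbers in `[0, 1]` without gaps. -/
theorem exists_monotone_enumeration {F : Finset ℚ} (hF : ∀ x ∈ F, 0 ≤ x ∧ x ≤ 1) (h0 : 0 ∈ F)
    (h1 : 1 ∈ F) :
    ∃ r : ℕ → ℚ, Monotone r ∧ r 0 = 0 ∧ r F.card = 1 ∧ (∀ j, r j ∈ F) ∧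
      ∀ j, ∀ x ∈ F, x ≤ r j ∨ r (j + 1) ≤ x := by
  set f := F.orderEmbOfFin rfl with hf
  have hcard : 0 < F.card := Finset.card_pos.2 ⟨0, h0⟩
  have hrange : ∀ x ∈ F, ∃ i, f i = x := fun x hx => by
    have : x ∈ Set.range f := by rw [hf, Finset.range_orderEmbOfFin]; exact hx
    exact this
  have hmem : ∀ i, f i ∈ F := Finset.orderEmbOfFin_mem F rfl
  refine ⟨fun j => if h : j < F.card then f ⟨j, h⟩ else 1, ?_, ?_, by simp, ?_, ?_⟩
  · intro i j hij
    dsimp only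
    split_ifs with hi hj
    · exact f.monotone hij
    · exact (hF _ (hmem _)).2
    · omega
    · exact le_rfl
  · dsimp only
    rw [dif_pos hcard]
    obtain ⟨i, hi⟩ := hrange 0 h0
    refine le_antisymm ?_ (hF _ (hmem _)).1
    rw [← hi]
    exact f.monotone (Nat.zero_le _)
  · intro j
    dsimp only
    split_ifs
    · exact hmem _
    · exact h1
  · intro j x hx
    obtain ⟨i, rfl⟩ := hrange x hx
    dsimp only
    by_cases hij : (i : ℕ) ≤ j
    · left
      split_ifs with hj
      · exact f.monotone hij
      · exact (hF _ hx).2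
    · right
      rw [dif_pos (by omega : j + 1 < F.card)]
      exact f.monotone (by rw [Fin.le_def]; simp only; omega)

namespace OneCounterNet

/-- A sign change from positive at `r` to negative at `s` forces both coordinates of `α` to be
negative, and then `-α` has a slope strictly inside the gap. -/
theorem tilt_nonneg_of_boxSlopes {k : ℕ} {r s : ℚ} (hr : 0 ≤ r) (hrs : r ≤ s) (hs : s ≤ 1)
    (hgap : ∀ x ∈ boxSlopes k, x ≤ r ∨ s ≤ x) {α : ℤ × ℤ} (hα : InBox k α)
    (h : 0 < tilt r α) : 0 ≤ tilt s α := by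
  by_contra! hneg
  obtain ⟨x, y⟩ := α
  simp only [tilt] at h hneg
  have hsum : (x : ℚ) + y < 0 := by
    by_contra! hc
    linarith [mul_le_mul_of_nonneg_right hrs hc]
  have hy : (y : ℚ) < 0 := by nlinarith
  have hx : (x : ℚ) < 0 := by nlinarith
  have hx' : x < 0 := by exact_mod_cast hx
  have hy' : y < 0 := by exact_mod_cast hy
  have hbx := (abs_le.1 hα.1).1
  have hby := (abs_le.1 hα.2).1
  dsimp only at hbx hby
  obtain ⟨a, ha⟩ := Int.eq_ofNat_of_zero_le (by omega : 0 ≤ -x)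
  obtain ⟨b, hb⟩ := Int.eq_ofNat_of_zero_le (by omega : 0 ≤ -y)
  have ha' : (a : ℚ) = -x := by exact_mod_cast ha.symm
  have hb' : (b : ℚ) = -y := by exact_mod_cast hb.symm
  have hpos : (0 : ℚ) < a + b := by rw [ha', hb']; linarith
  rcases hgap _ (mem_boxSlopes.2 ⟨a, b, by omega, by omega, rfl⟩) with hle | hle
  · rw [div_le_iff₀ hpos, ha', hb'] at hle
    linarith
  · rw [le_div_iff₀ hpos, ha', hb'] at hle
    linarith

/-! ### From slopes to integer vectors, and the belt -/

/-- The integer vector spanning the same line as `(1 - r, r)`. -/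
def slopeVector (r : ℚ) : ℤ × ℤ := (r.den - r.num, r.num)

theorem num_le_den {r : ℚ} (h : r ≤ 1) : r.num ≤ r.den := by
  rw [← Rat.num_div_den r, div_le_one (by exact_mod_cast r.den_pos)] at h
  exact_mod_cast h

theorem isPositiveVector_slopeVector {r : ℚ} (h0 : 0 ≤ r) (h1 : r ≤ 1) :
    IsPositiveVector (slopeVector r) := by
  have h2 := num_le_den h1
  have h3 := Rat.num_nonneg.2 h0
  refine ⟨by simp only [slopeVector]; omega, h3, fun h => ?_⟩
  have h4 : (r.den : ℤ) - r.num = 0 := congrArg Prod.fst h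
  have h5 : r.num = 0 := congrArg Prod.snd h
  have := r.den_pos
  omega

theorem intTilt_eq_slopeVector (r : ℚ) (x : ℤ × ℤ) :
    intTilt r x = (slopeVector r).2 * x.1 - (slopeVector r).1 * x.2 := by
  simp only [intTilt, slopeVector]
  ring

theorem cast_pos_of_isPositiveVector {ρ : ℤ × ℤ} (h : IsPositiveVector ρ) :
    (0 : ℝ) ≤ ρ.1 ∧ (0 : ℝ) ≤ ρ.2 ∧ ((0 : ℝ) < ρ.1 ∨ (0 : ℝ) < ρ.2) := by
  obtain ⟨h1, h2, h3⟩ := h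
  refine ⟨by exact_mod_cast h1, by exact_mod_cast h2, ?_⟩
  by_contra! h4
  exact h3 (Prod.ext (le_antisymm (by exact_mod_cast h4.1) h1)
    (le_antisymm (by exact_mod_cast h4.2) h2))

theorem tilt_lt_of_intTilt_lt {r : ℚ} {x : ℤ × ℤ} {c : ℤ} (h : intTilt r x < c * r.den) :
    tilt r x < c := by
  have hd : (0 : ℚ) < r.den := by exact_mod_cast r.den_pos
  have h' : (intTilt r x : ℚ) < c * r.den := by exact_mod_cast h
  rw [intTilt_eq, mul_comm] at h'
  exact lt_of_mul_lt_mul_right h' hd.le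

theorem lt_tilt_of_lt_intTilt {r : ℚ} {x : ℤ × ℤ} {c : ℤ} (h : c * r.den < intTilt r x) :
    c < tilt r x := by
  have hd : (0 : ℚ) < r.den := by exact_mod_cast r.den_pos
  have h' : (c * r.den : ℚ) < intTilt r x := by exact_mod_cast h
  rw [intTilt_eq, mul_comm (r.den : ℚ)] at h'
  exact lt_of_mul_lt_mul_right h' hd.le

theorem tilt_lt_of_isAbove {r : ℚ} (h0 : 0 ≤ r) (h1 : r ≤ 1) {c : ℕ} {x : ℤ × ℤ}
    (h : IsAbove c (slopeVector r) x) : tilt r x < -(c : ℚ) := by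
  obtain ⟨_, ⟨t, ht, rfl⟩, hx, hy⟩ := h
  obtain ⟨p1, p2, p3⟩ := cast_pos_of_isPositiveVector (isPositiveVector_slopeVector h0 h1)
  have hden : ((slopeVector r).1 : ℝ) + (slopeVector r).2 = r.den := by simp [slopeVector]
  dsimp only at hx hy
  have key : (intTilt r x : ℝ) < (-c : ℤ) * r.den := by
    rw [intTilt_eq_slopeVector, ← hden]
    push_cast
    rcases p3 with p3 | p3
    · nlinarith [mul_lt_mul_of_pos_left hy p3, mul_le_mul_of_nonneg_left hx.le p2]
    · nlinarith [mul_le_mul_of_nonneg_left hy.le p1, mul_lt_mul_of_pos_left hx p3]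
  have := tilt_lt_of_intTilt_lt (c := -c) (by exact_mod_cast key)
  push_cast at this
  exact this

theorem lt_tilt_of_isBelow {r : ℚ} (h0 : 0 ≤ r) (h1 : r ≤ 1) {c : ℕ} {x : ℤ × ℤ}
    (h : IsBelow c (slopeVector r) x) : (c : ℚ) < tilt r x := by
  obtain ⟨_, ⟨t, ht, rfl⟩, hx, hy⟩ := h
  obtain ⟨p1, p2, p3⟩ := cast_pos_of_isPositiveVector (isPositiveVector_slopeVector h0 h1)
  have hden : ((slopeVector r).1 : ℝ) + (slopeVector r).2 = r.den := by simp [slopeVector]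
  dsimp only at hx hy
  have key : ((c : ℤ) : ℝ) * r.den < intTilt r x := by
    rw [intTilt_eq_slopeVector, ← hden]
    push_cast
    rcases p3 with p3 | p3
    · nlinarith [mul_lt_mul_of_pos_left hy p3, mul_le_mul_of_nonneg_left hx.le p2]
    · nlinarith [mul_le_mul_of_nonneg_left hy.le p1, mul_lt_mul_of_pos_left hx p3]
  have := lt_tilt_of_lt_intTilt (c := c) (by exact_mod_cast key)
  push_cast at this
  exact this

variable {Q : Type u} {Q' : Type v} {A : Type w} (N : OneCounterNet Q A) (N' : OneCounterNet Q' A)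

/-- The belt theorem with explicit bounds. -/
theorem exists_belt [Finite Q] [Finite Q'] (q : Q) (q' : Q') :
    ∃ ρ : ℤ × ℤ, IsPositiveVector ρ ∧
      ρ.1 ≤ (2 * (scc N N' + 1) + 1 : ℕ) ∧ ρ.2 ≤ (2 * (scc N N' + 1) + 1 : ℕ) ∧
      (∀ n n' : ℕ,
        IsAbove (acyc N N' + (scc N N' + 2) * (scc N N' + 2) * (2 * scc N N')) ρ
          ((n : ℤ), (n' : ℤ)) → N.Sim N' q n q' n') ∧
      (∀ n n' : ℕ,
        IsBelow (acyc N N' + (scc N N' + 2) * (scc N N' + 2) * (2 * scc N N')) ρ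
          ((n : ℤ), (n' : ℤ)) → ¬ N.Sim N' q n q' n') := by
  classical
  -- The `+ 1` keeps slope 1 in the list even if `scc` is 0.
  set k := scc N N' + 1 with hk
  set c := acyc N N' + (scc N N' + 2) * (scc N N' + 2) * (2 * scc N N') with hc
  obtain ⟨r, hmono, hr0, hrK, hrF, hgap⟩ := exists_monotone_enumeration
    (fun x hx => boxSlopes_mem_Icc hx) (zero_mem_boxSlopes k) (one_mem_boxSlopes (by omega))
  set K := (boxSlopes k).card with hK
  have h0 : ∀ j, 0 ≤ r j := fun j => (boxSlopes_mem_Icc (hrF j)).1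
  have h1 : ∀ j, r j ≤ 1 := fun j => (boxSlopes_mem_Icc (hrF j)).2
  have hbox : ∀ j α, InBox (scc N N') α → 0 < tilt (r j) α → 0 ≤ tilt (r (j + 1)) α :=
    fun j α hα => tilt_nonneg_of_boxSlopes (h0 j) (hmono j.le_succ) (h1 _) (hgap j)
      (hα.mono (by omega))
  have hmargin : ∀ j ≤ K, (margin N N' (q, q') j : ℚ) ≤ c := by
    intro j hj
    norm_cast
    exact add_le_add (longestPath_le_acyc N N' _)
      (Nat.mul_le_mul_right _ (hj.trans (card_boxSlopes_le k)))
  -- At the two ends nothing is left to win: no point of the quadrant is above the line of slope 1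
  -- or below that of slope 0.
  have hex : ∃ j, j = K ∨ ¬ SpoilerWins N N' r (j + 1) (q, q') := ⟨K, .inl rfl⟩
  obtain ⟨j, hj, hjmin⟩ : ∃ j, (j = K ∨ ¬ SpoilerWins N N' r (j + 1) (q, q')) ∧
      (j ≤ K ∧ (j = 0 ∨ SpoilerWins N N' r j (q, q'))) := by
    refine ⟨Nat.find hex, Nat.find_spec hex, Nat.find_min' hex (.inl rfl), ?_⟩
    cases hfind : Nat.find hex with
    | zero => exact .inl rfl
    | succ i =>
      have := Nat.find_min hex (m := i) (by omega)
      simp only [not_or, not_not] at this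
      exact .inr this.2
  have hden := den_le_of_mem_boxSlopes (hrF j)
  have hpos := isPositiveVector_slopeVector (h0 j) (h1 j)
  have hsum : (slopeVector (r j)).1 + (slopeVector (r j)).2 = (r j).den := by simp [slopeVector]
  obtain ⟨hp1, hp2, -⟩ := id hpos
  refine ⟨slopeVector (r j), hpos, by omega, by omega, fun n n' hx => ?_, fun n n' hx => ?_⟩
  · have ht := tilt_lt_of_isAbove (h0 j) (h1 j) hx
    rcases hj with rfl | hj
    · rw [hrK, tilt] at ht
      push_cast at ht
      have h2 : (0 : ℚ) ≤ n := n.cast_nonneg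
      have h3 : (0 : ℚ) ≤ c := c.cast_nonneg
      linarith
    · exact sim_of_not_spoilerWins hmono hr0 h1 hj (by linarith [hmargin j hjmin.1])
  · have ht := lt_tilt_of_isBelow (h0 j) (h1 j) hx
    rcases hjmin.2 with rfl | hw
    · rw [hr0, tilt] at ht
      push_cast at ht
      have h2 : (0 : ℚ) ≤ n' := n'.cast_nonneg
      have h3 : (0 : ℚ) ≤ c := c.cast_nonneg
      linarith
    · exact not_sim_of_spoilerWins hmono hr0 h1 hbox hw ((hmargin j hjmin.1).trans_lt ht)

theorem natCard_mul_le_size_sq :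
    Nat.card Q * Nat.card Q' ≤ (N.size + N'.size) ^ 2 := by
  rw [sq]
  refine Nat.mul_le_mul ?_ ?_ <;> simp only [size] <;> omega

end OneCounterNet

open Polynomial in
theorem theorem2 :
    ∃ P S : Polynomial ℕ,
      ∀ (Q : Type u) (Q' : Type v) (A : Type w) [Finite Q] [Finite Q'] [Finite A]
        (N : OneCounterNet Q A) (N' : OneCounterNet Q' A),
        ∃ c : ℕ,
          c ≤ P.eval (N.size + N'.size) ∧
          c ≤ S.eval (OneCounterNet.scc N N') + OneCounterNet.acyc N N' ∧
          ∀ (q : Q) (q' : Q'), ∃ ρ : ℤ × ℤ,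
            IsPositiveVector ρ ∧
            ρ.1 ≤ (P.eval (N.size + N'.size) : ℕ) ∧
            ρ.2 ≤ (P.eval (N.size + N'.size) : ℕ) ∧
            (∀ n n' : ℕ, IsAbove c ρ ((n : ℤ), (n' : ℤ)) → OneCounterNet.Sim N N' q n q' n') ∧
            (∀ n n' : ℕ, IsBelow c ρ ((n : ℤ), (n' : ℤ)) → ¬ OneCounterNet.Sim N N' q n q' n') := by
  -- `X ^ 2` bounds both `acyc` and `scc`; the last summand of `P` bounds the entries of the vector.
  refine ⟨X ^ 2 + (X ^ 2 + 2) * (X ^ 2 + 2) * (2 * X ^ 2) + (2 * (X ^ 2 + 1) + 1),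
    (X + 2) * (X + 2) * (2 * X), fun Q Q' A _ _ _ N N' => ?_⟩
  have hscc := (OneCounterNet.scc_le N N').trans (OneCounterNet.natCard_mul_le_size_sq N N')
  have hacyc := (OneCounterNet.acyc_le N N').trans (OneCounterNet.natCard_mul_le_size_sq N N')
  simp only [eval_add, eval_mul, eval_pow, eval_X, eval_ofNat, eval_one]
  refine ⟨OneCounterNet.acyc N N' + (OneCounterNet.scc N N' + 2) * (OneCounterNet.scc N N' + 2) *
    (2 * OneCounterNet.scc N N'), ?_, (Nat.add_comm _ _).le, fun q q' => ?_⟩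
  · exact (by gcongr : _ ≤ _).trans (Nat.le_add_right _ _)
  · obtain ⟨ρ, hρ, h1, h2, h3⟩ := OneCounterNet.exists_belt N N' q q'
    have hle : 2 * (OneCounterNet.scc N N' + 1) + 1 ≤ (N.size + N'.size) ^ 2 +
        ((N.size + N'.size) ^ 2 + 2) * ((N.size + N'.size) ^ 2 + 2) *
          (2 * (N.size + N'.size) ^ 2) + (2 * ((N.size + N'.size) ^ 2 + 1) + 1) :=
      le_add_left (by gcongr)
    exact ⟨ρ, hρ, h1.trans (by exact_mod_cast hle), h2.trans (by exact_mod_cast hle), h3⟩
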